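/- Let $R$ be a (commutative, noetherian) Cohen--Macaulay local ring of Krull dimension $d$ that has a canonical module $\omega$, that is, a finitely generated maximal Cohen--Macaulay module of finite injective dimension and of type one. Call a finitely generated $R$-module $X$ maximal Cohen--Macaulay if $\operatorname{depth} X_{\mathfrak p}=\dim R_{\mathfrak p}$ for all $\mathfrak p\in\operatorname{Supp} X$ (so that $X=0$ is allowed). Let $M$ and $N$ be finitely generated $R$-modules, and assume that $N$ is maximal Cohen--Macaulay. If $\operatorname{Ext}_R^i(M,N)=0$ for all integers $i$ with $1\le i\le d$, then $M\otimes_R\operatorname{Hom}_R(N,\omega)$ is a maximal Cohen--Macaulay $R$-module. -/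

import Mathlib

universe u

open scoped TensorProduct

namespace CohenMacaulay

/-- The depth of a module `M` over a local ring `(R, 𝔪)`: the supremum of the lengths of the
`M`-sequences contained in `𝔪`. If `R` is noetherian and `M` is finitely generated and nonzero,
weakly regular sequences in `𝔪` are automatically regular by Nakayama's lemma; the zero
module has depth `∞`. -/
noncomputable def depth (R M : Type u) [CommRing R] [IsLocalRing R] [AddCommGroup M]
    [Module R M] : ℕ∞ :=
  ⨆ (rs : List R) (_ : (∀ r ∈ rs, r ∈ IsLocalRing.maximalIdeal R) ∧
    RingTheory.Sequence.IsWeaklyRegular M rs), (rs.length : ℕ∞)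

/-- A local ring `R` is Cohen--Macaulay if it is noetherian and `depth R = dim R`. -/
structure IsCohenMacaulayLocalRing (R : Type u) [CommRing R] [IsLocalRing R] : Prop where
  isNoetherianRing : IsNoetherianRing R
  depth_eq : (depth R R : WithBot ℕ∞) = ringKrullDim R

/-- A finitely generated module `M` over a noetherian ring `R` is maximal Cohen--Macaulay if
`depth M_𝔭 = dim R_𝔭` for all `𝔭` in the support of `M`. The zero module is maximal
Cohen--Macaulay. -/
structure IsMaximalCohenMacaulay (R M : Type u) [CommRing R] [AddCommGroup M]
    [Module R M] : Prop where
  finite : Module.Finite R M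
  depth_eq : ∀ p ∈ Module.support R M,
    (depth (Localization.AtPrime p.asIdeal)
      (LocalizedModule p.asIdeal.primeCompl M) : WithBot ℕ∞) =
      ringKrullDim (Localization.AtPrime p.asIdeal)

/-- A canonical module of a Cohen--Macaulay local ring `(R, 𝔪, k)` of dimension `d`: a maximal
Cohen--Macaulay module `ω` of finite injective dimension and of type one, that is, such that
`Ext^d(k, ω)` is one-dimensional over `k`. -/
structure IsCanonicalModule (R ω : Type u) [CommRing R] [IsLocalRing R] [AddCommGroup ω]
    [Module R ω] : Prop where
  isMaximalCohenMacaulay : IsMaximalCohenMacaulay R ω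
  finite_injectiveDimension :
    ∃ n : ℕ, CategoryTheory.HasInjectiveDimensionLE (ModuleCat.of R ω) n
  type_eq_one : ∃ d : ℕ, ringKrullDim R = d ∧
    Nonempty (CategoryTheory.Abelian.Ext
      (ModuleCat.of R (IsLocalRing.ResidueField R)) (ModuleCat.of R ω) d ≃ₗ[R]
        IsLocalRing.ResidueField R)

end CohenMacaulay

/-! The natural map `tensorEval` from `M ⊗ Hom(N, ω)` to `Hom(Hom(M, N), ω)` is an isomorphism, and
its target is maximal Cohen--Macaulay.

For the target, a free resolution of `M` shows that vanishing of `Ext^i(M, N)` lets `Hom(M, N)`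
inherit depth `d` from `N` (`extDepthGE_linearMap`). Finite injective dimension of `ω` gives
`Ext^i(Y, ω) = 0` for `i > 0` and `Y` of depth at least `d` (`ExtDepthGE.extVanishes`), so dualizing
into `ω` preserves depth `d`.

For the isomorphism, take `F → M` finite free with kernel `K`. The image of `Hom(F, N) → Hom(K, N)`
has depth `d`, so functionals on `Hom(M, N)` extend to `Hom(F, N)`; this gives surjectivity for `M`,
and likewise for `K`. A diagram chase using `Ext^1(M, N) = 0` then gives injectivity.

Depth is handled as vanishing of `Ext^i(k, -)`, compared with the localized definition by
`IsMaximalCohenMacaulay.extDepthGE` and `ExtDepthGE.isMaximalCohenMacaulay`. -/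

namespace CohenMacaulay

open CategoryTheory Abelian IsLocalRing RingTheory.Sequence Pointwise

/-! ### Vanishing of Ext along short exact sequences -/

section LongExactSequences

variable {R : Type u} [CommRing R] {A B C X Y : Type u} [AddCommGroup A] [AddCommGroup B]
  [AddCommGroup C] [AddCommGroup X] [AddCommGroup Y] [Module R A] [Module R B] [Module R C]
  [Module R X] [Module R Y] {f : A →ₗ[R] B} {g : B →ₗ[R] C}

/-- The module `Ext^i(X, Y)` vanishes. -/
abbrev ExtVanishes (R X Y : Type u) [CommRing R] [AddCommGroup X] [AddCommGroup Y] [Module R X]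
    [Module R Y] (i : ℕ) : Prop :=
  Subsingleton (Ext (ModuleCat.of R X) (ModuleCat.of R Y) i)

lemma extVanishes_congr_right (e : A ≃ₗ[R] B) {i : ℕ} (h : ExtVanishes R X A i) :
    ExtVanishes R X B i := by
  refine subsingleton_of_forall_eq 0 fun x ↦ ?_
  have key : (x.comp (Ext.mk₀ e.symm.toModuleIso.hom) (add_zero i)).comp
      (Ext.mk₀ e.symm.toModuleIso.inv) (add_zero i) = x := by
    rw [Ext.comp_assoc_of_second_deg_zero, Ext.mk₀_comp_mk₀, Iso.hom_inv_id, Ext.comp_mk₀_id]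
  rw [← key, Subsingleton.elim (x.comp (Ext.mk₀ e.symm.toModuleIso.hom) (add_zero i)) 0,
    Ext.zero_comp]

lemma extVanishes_congr_left (e : A ≃ₗ[R] B) {i : ℕ} (h : ExtVanishes R A Y i) :
    ExtVanishes R B Y i := by
  refine subsingleton_of_forall_eq 0 fun x ↦ ?_
  have key : (Ext.mk₀ e.toModuleIso.inv).comp ((Ext.mk₀ e.toModuleIso.hom).comp x (zero_add i))
      (zero_add i) = x := by
    rw [Ext.mk₀_comp_mk₀_assoc, Iso.inv_hom_id, Ext.mk₀_id_comp]
  rw [← key, Subsingleton.elim ((Ext.mk₀ e.toModuleIso.hom).comp x (zero_add i)) 0,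
    Ext.comp_zero]

lemma extVanishes_of_subsingleton_left [Subsingleton X] (i : ℕ) : ExtVanishes R X Y i :=
  subsingleton_of_forall_eq 0 fun x ↦ by
    rw [← x.mk₀_id_comp,
      (ModuleCat.isZero_of_subsingleton (ModuleCat.of R X)).eq_zero_of_src (𝟙 _), Ext.mk₀_zero,
      Ext.zero_comp]

lemma extVanishes_of_subsingleton_right [Subsingleton Y] (i : ℕ) : ExtVanishes R X Y i :=
  subsingleton_of_forall_eq 0 fun x ↦ by
    rw [← x.comp_mk₀_id,
      (ModuleCat.isZero_of_subsingleton (ModuleCat.of R Y)).eq_zero_of_src (𝟙 _), Ext.mk₀_zero,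
      Ext.comp_zero]

lemma extVanishes_of_projective [Module.Projective R X] (i : ℕ) : ExtVanishes R X Y (i + 1) :=
  have : Projective (ModuleCat.of R X) := (IsProjective.iff_projective X).mp inferInstance
  Ext.subsingleton_of_projective _ _ _

lemma extVanishes_zero_iff : ExtVanishes R X Y 0 ↔ Subsingleton (X →ₗ[R] Y) :=
  (Ext.addEquiv₀.trans ModuleCat.homAddEquiv).toEquiv.subsingleton_congr

lemma shortExact_of_exact (hf : Function.Injective f) (hfg : Function.Exact f g)
    (hg : Function.Surjective g) :
    (ModuleCat.shortComplexOfCompEqZero f g hfg.linearMap_comp_eq_zero).ShortExact where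
  exact := ModuleCat.shortComplex_exact _ hfg
  mono_f := (ModuleCat.mono_iff_injective _).mpr hf
  epi_g := (ModuleCat.epi_iff_surjective _).mpr hg

variable (hf : Function.Injective f) (hfg : Function.Exact f g) (hg : Function.Surjective g)

include hf hfg hg

lemma extVanishes_first_right {i : ℕ} (hB : ExtVanishes R X B (i + 1))
    (hC : ExtVanishes R X C i) : ExtVanishes R X A (i + 1) := by
  refine subsingleton_of_forall_eq 0 fun x ↦ ?_
  obtain ⟨y, rfl⟩ := Ext.covariant_sequence_exact₁ (ModuleCat.of R X)
    (shortExact_of_exact hf hfg hg) x (hB.elim _ _) rfl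
  rw [hC.elim y 0, Ext.zero_comp]

lemma extVanishes_last_right {i : ℕ} (hB : ExtVanishes R X B i)
    (hA : ExtVanishes R X A (i + 1)) : ExtVanishes R X C i := by
  refine subsingleton_of_forall_eq 0 fun x ↦ ?_
  obtain ⟨y, rfl⟩ := Ext.covariant_sequence_exact₃ (ModuleCat.of R X)
    (shortExact_of_exact hf hfg hg) x rfl (hA.elim _ _)
  rw [hB.elim y 0, Ext.zero_comp]

lemma extVanishes_middle_left {i : ℕ} (hA : ExtVanishes R A Y i) (hC : ExtVanishes R C Y i) :
    ExtVanishes R B Y i := by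
  refine subsingleton_of_forall_eq 0 fun x ↦ ?_
  obtain ⟨y, rfl⟩ := Ext.contravariant_sequence_exact₂ (shortExact_of_exact hf hfg hg)
    (ModuleCat.of R Y) x (hA.elim _ _)
  rw [hC.elim y 0, Ext.comp_zero]

lemma extVanishes_first_left {i : ℕ} (hB : ExtVanishes R B Y i)
    (hC : ExtVanishes R C Y (i + 1)) : ExtVanishes R A Y i := by
  refine subsingleton_of_forall_eq 0 fun x ↦ ?_
  obtain ⟨y, rfl⟩ := Ext.contravariant_sequence_exact₁ (shortExact_of_exact hf hfg hg)
    (ModuleCat.of R Y) x (add_comm 1 i) (hC.elim _ _)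
  rw [hB.elim y 0, Ext.comp_zero]

lemma extVanishes_last_left {i : ℕ} (hB : ExtVanishes R B Y (i + 1))
    (hA : ExtVanishes R A Y i) : ExtVanishes R C Y (i + 1) := by
  refine subsingleton_of_forall_eq 0 fun x ↦ ?_
  obtain ⟨y, rfl⟩ := Ext.contravariant_sequence_exact₃ (shortExact_of_exact hf hfg hg)
    (ModuleCat.of R Y) x (hB.elim _ _) (add_comm 1 i)
  rw [hA.elim y 0, Ext.comp_zero]

lemma exists_extension_of_extVanishes (hC : ExtVanishes R C Y 1) (φ : A →ₗ[R] Y) :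
    ∃ ψ : B →ₗ[R] Y, ψ ∘ₗ f = φ := by
  let φ' : ModuleCat.of R A ⟶ ModuleCat.of R Y := ModuleCat.ofHom φ
  obtain ⟨y, hy⟩ := Ext.contravariant_sequence_exact₁ (shortExact_of_exact hf hfg hg)
    (ModuleCat.of R Y) (Ext.mk₀ φ') (add_zero 1) (hC.elim _ _)
  obtain ⟨ψ, rfl⟩ := (Ext.mk₀_bijective _ _).2 y
  rw [Ext.mk₀_comp_mk₀, (Ext.mk₀_bijective _ _).1.eq_iff] at hy
  exact ⟨ψ.hom, by simpa [φ'] using! congrArg ModuleCat.Hom.hom hy⟩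

end LongExactSequences

lemma extVanishes_pi {R X N : Type u} [CommRing R] [AddCommGroup X] [AddCommGroup N]
    [Module R X] [Module R N] {ι : Type u} [Fintype ι] {i : ℕ} (h : ExtVanishes R X N i) :
    ExtVanishes R X (ι → N) i := by
  classical
  refine subsingleton_of_forall_eq 0 fun x ↦ ?_
  -- The identity of `N^ι` is a sum of maps factoring through `N`.
  have key : ∑ j : ι, ModuleCat.ofHom (LinearMap.proj (R := R) (φ := fun _ : ι ↦ N) j) ≫
      ModuleCat.ofHom (LinearMap.single R (fun _ : ι ↦ N) j) = 𝟙 (ModuleCat.of R (ι → N)) := by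
    ext v j
    simp [ModuleCat.hom_sum, Finset.sum_apply, Pi.single_apply]
  rw [← x.comp_mk₀_id, ← key, Ext.mk₀_sum, Ext.comp_sum]
  refine Finset.sum_eq_zero fun j _ ↦ ?_
  rw [← Ext.mk₀_comp_mk₀, ← Ext.comp_assoc_of_second_deg_zero, h.elim (x.comp _ _) 0,
    Ext.zero_comp]

/-! ### Regular elements and prime avoidance -/

section RegularElements

variable {R X : Type u} [CommRing R] [AddCommGroup X] [Module R X]

lemma exact_smul_mkQ (x : R) :
    Function.Exact (LinearMap.lsmul R X x) (x • (⊤ : Submodule R X)).mkQ :=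
  LinearMap.exact_lsmul_mkQ_smul_top X x

lemma mem_support_quotSMulTop [Module.Finite R X] {p : PrimeSpectrum R}
    (hp : p ∈ Module.support R X) {x : R} (hx : x ∈ p.asIdeal) :
    p ∈ Module.support R (QuotSMulTop x X) := by
  rw [Module.support_quotSMulTop]
  exact ⟨hp, by simpa using hx⟩

lemma exists_mem_isSMulRegular [IsNoetherianRing R] [Module.Finite R X]
    {p : Ideal R}
    (hp : ∀ q ∈ associatedPrimes R X, ¬ p ≤ q) : ∃ x ∈ p, IsSMulRegular X x := by
  by_contra! H
  have hfin := associatedPrimes.finite R X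
  have hsub : (p : Set R) ⊆ ⋃ q ∈ hfin.toFinset, (q : Set R) := by
    intro x hx
    have : x ∈ ⋃ q ∈ associatedPrimes R X, (q : Set R) := by
      rw [biUnion_associatedPrimes_eq_zero_divisors]
      have := H x hx
      rw [isSMulRegular_iff_right_eq_zero_of_smul] at this
      push Not at this
      obtain ⟨y, hy, hy0⟩ := this
      exact ⟨y, hy0, hy⟩
    simpa using this
  -- The two `⊤` are the indices exempt from primeness; every ideal here is prime, so they are
  -- arbitrary.
  obtain ⟨q, hq, hpq⟩ := (Ideal.subset_union_prime (s := hfin.toFinset) (f := id) ⊤ ⊤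
    fun q hq _ _ ↦ (hfin.mem_toFinset.mp hq).isPrime).mp hsub
  exact hp q (hfin.mem_toFinset.mp hq) hpq

end RegularElements

/-! ### Homological depth and associated primes -/

section ExtDepth

variable {R : Type u} [CommRing R] [IsLocalRing R] {A B C X N : Type u} [AddCommGroup A]
  [AddCommGroup B] [AddCommGroup C] [AddCommGroup X] [AddCommGroup N] [Module R A] [Module R B]
  [Module R C] [Module R X] [Module R N] {f : A →ₗ[R] B} {g : B →ₗ[R] C}

/-- The homological form of the condition `e ≤ depth X` over a local ring with residue
field `k`: the vanishing of `Ext^i(k, X)` for `i < e`. -/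
def ExtDepthGE (R X : Type u) [CommRing R] [IsLocalRing R] [AddCommGroup X] [Module R X]
    (e : ℕ) : Prop :=
  ∀ i < e, ExtVanishes R (ResidueField R) X i

lemma ExtDepthGE.mono {e e' : ℕ} (h : ExtDepthGE R X e) (he : e' ≤ e) : ExtDepthGE R X e' :=
  fun i hi ↦ h i (hi.trans_le he)

lemma ExtDepthGE.congr {e : ℕ} (h : ExtDepthGE R A e) (l : A ≃ₗ[R] B) : ExtDepthGE R B e :=
  fun i hi ↦ extVanishes_congr_right l (h i hi)

lemma ExtDepthGE.of_subsingleton [Subsingleton X] (e : ℕ) : ExtDepthGE R X e :=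
  fun i _ ↦ extVanishes_of_subsingleton_right i

lemma ExtDepthGE.of_injective (hf : Function.Injective f) (hB : ExtDepthGE R B 1) :
    ExtDepthGE R A 1 := by
  intro i hi
  obtain rfl : i = 0 := by omega
  have := extVanishes_zero_iff.mp (hB 0 hi)
  refine extVanishes_zero_iff.mpr (subsingleton_of_forall_eq 0 fun x ↦ LinearMap.ext fun r ↦ hf ?_)
  simpa using DFunLike.congr_fun (Subsingleton.elim (f ∘ₗ x) 0) r

lemma ExtDepthGE.of_shortExact (hf : Function.Injective f) (hfg : Function.Exact f g)
    (hg : Function.Surjective g) {e : ℕ} (hB : ExtDepthGE R B (e + 1)) (hC : ExtDepthGE R C e) :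
    ExtDepthGE R A (e + 1) := by
  intro i hi
  match i with
  | 0 => exact (hB.mono (by omega)).of_injective hf 0 one_pos
  | i + 1 => exact extVanishes_first_right hf hfg hg (hB _ hi) (hC _ (by omega))

lemma ExtDepthGE.pi {ι : Type u} [Fintype ι] {e : ℕ} (h : ExtDepthGE R N e) :
    ExtDepthGE R (ι → N) e :=
  fun i hi ↦ extVanishes_pi (h i hi)

lemma ExtDepthGE.linearMap_of_free {F : Type u} [AddCommGroup F] [Module R F] [Module.Free R F]
    [Module.Finite R F] {e : ℕ} (h : ExtDepthGE R N e) : ExtDepthGE R (F →ₗ[R] N) e :=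
  h.pi.congr ((Module.Free.chooseBasis R F).constr R)

lemma ExtDepthGE.quotSMulTop {x : R} (hx : IsSMulRegular X x) {e : ℕ}
    (h : ExtDepthGE R X (e + 1)) : ExtDepthGE R (QuotSMulTop x X) e :=
  fun i hi ↦ extVanishes_last_right (f := LinearMap.lsmul R X x) hx (exact_smul_mkQ x)
    (Submodule.mkQ_surjective _) (h i (by omega)) (h (i + 1) (by omega))

lemma maximalIdeal_smul_lt_top [Module.Finite R X] [Nontrivial X] :
    maximalIdeal R • (⊤ : Submodule R X) < ⊤ :=
  (Submodule.top_ne_ideal_smul_of_le_jacobson_annihilator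
    (maximalIdeal_le_jacobson _)).symm.lt_top

lemma support_residueField :
    Module.support R (ResidueField R) = PrimeSpectrum.zeroLocus (maximalIdeal R) := by
  rw [Module.support_eq_zeroLocus]
  exact congrArg _ (congrArg _ (Ideal.annihilator_quotient (I := maximalIdeal R)))

variable [IsNoetherianRing R]

lemma extDepthGE_iff_exists_isRegular [Module.Finite R X] [Nontrivial X] {e : ℕ} :
    ExtDepthGE R X e ↔
      ∃ rs : List R, rs.length = e ∧ (∀ r ∈ rs, r ∈ maximalIdeal R) ∧ IsRegular X rs := by
  constructor
  · intro h
    exact ModuleCat.exists_isRegular_of_exists_subsingleton_ext (maximalIdeal R) e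
      (ModuleCat.of R X) maximalIdeal_smul_lt_top (ModuleCat.of R (ResidueField R))
      support_residueField h
  · rintro ⟨rs, rfl, hmem, hreg⟩
    exact ModuleCat.subsingleton_ext_of_exists_isRegular (maximalIdeal R)
      (ModuleCat.of R (ResidueField R)) support_residueField.subset
      (ModuleCat.of R X) maximalIdeal_smul_lt_top rs hmem hreg

/-- If the submodule `U` killed by `q` lay inside `xX`, regularity of `x` would give `U = xU`, and
Nakayama `U = 0`. So some `u ∈ U` survives in `X/xX`, where it is killed by both `q` and `x`; and `x
∉ q` by regularity. -/
lemma exists_associatedPrime_quotSMulTop [Module.Finite R X] {x : R} (hx : IsSMulRegular X x)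
    (hxm : x ∈ maximalIdeal R) {q : Ideal R} (hq : q ∈ associatedPrimes R X) :
    ∃ q' ∈ associatedPrimes R (QuotSMulTop x X), q < q' := by
  obtain ⟨hqp, v, hv⟩ := isAssociatedPrime_iff.mp hq
  have hv0 : v ≠ 0 := by
    rintro rfl
    exact hqp.ne_top (by simp [hv])
  set U : Submodule R X := Submodule.torsionBySet R X q with hU
  have hvU : v ∈ U := by
    rw [hU, Submodule.mem_torsionBySet_iff]
    rintro ⟨a, ha⟩
    have ha' : a ∈ q := ha
    rw [hv, Submodule.mem_colon_singleton] at ha'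
    simpa using ha'
  obtain ⟨u, huU, hux⟩ : ∃ u ∈ U, u ∉ x • (⊤ : Submodule R X) := by
    by_contra! H
    have : U ≤ maximalIdeal R • U := by
      intro u hu
      obtain ⟨w, -, rfl⟩ := H u hu
      refine Submodule.smul_mem_smul hxm ?_
      rw [hU, Submodule.mem_torsionBySet_iff] at hu ⊢
      intro a
      have := hu a
      simp only [DistribSMul.toLinearMap_apply] at this
      rw [smul_comm] at this
      exact hx.right_eq_zero_of_smul this
    have hbot := Submodule.eq_bot_of_le_smul_of_le_jacobson_bot (maximalIdeal R) U
      (IsNoetherian.noetherian U) this (maximalIdeal_le_jacobson _)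
    rw [hbot] at hvU
    exact hv0 (by simpa using hvU)
  obtain ⟨q', hq', hle⟩ := exists_le_isAssociatedPrime_of_isNoetherianRing R
    (Submodule.Quotient.mk (p := x • (⊤ : Submodule R X)) u)
    (by rwa [Ne, Submodule.Quotient.mk_eq_zero])
  refine ⟨q', hq', lt_of_le_not_ge (fun a ha ↦ hle ?_) fun h ↦ ?_⟩
  · rw [Submodule.mem_colon_singleton, ← Submodule.Quotient.mk_smul]
    rw [hU, Submodule.mem_torsionBySet_iff] at huU
    simp [huU ⟨a, ha⟩]
  · have hxq' : x ∈ q' := hle <| by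
      rw [Submodule.mem_colon_singleton, ← Submodule.Quotient.mk_smul, Submodule.mem_bot,
        Submodule.Quotient.mk_eq_zero]
      exact Submodule.smul_mem_pointwise_smul _ _ _ trivial
    have hxq := h hxq'
    rw [hv, Submodule.mem_colon_singleton, Submodule.mem_bot] at hxq
    exact hv0 (hx (by simpa using hxq))

/-- Each regular element divided out strictly enlarges an associated prime, raising its height by at
least one. -/
lemma height_add_le_of_mem_associatedPrimes [Module.Finite R X] {e : ℕ} (h : ExtDepthGE R X e)
    {q : Ideal R} (hq : q ∈ associatedPrimes R X) :
    q.height + e ≤ ringKrullDim R := by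
  induction e generalizing X q with
  | zero =>
    have := hq.isPrime
    simpa using Ideal.height_le_ringKrullDim_of_ne_top hq.isPrime.ne_top
  | succ e ih =>
    have hnt : Nontrivial X := by
      by_contra! H
      exact not_isAssociatedPrime_of_subsingleton hq
    obtain ⟨rs, hlen, hmem, hreg⟩ := extDepthGE_iff_exists_isRegular.mp h
    match rs with
    | [] => simp at hlen
    | x :: rs =>
      have hx := ((isRegular_cons_iff _ _ _).mp hreg).1
      have hxm := hmem x (by simp)
      obtain ⟨q', hq', hlt⟩ := exists_associatedPrime_quotSMulTop hx hxm hq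
      have := hq.isPrime
      have := hq'.isPrime
      refine le_trans ?_ (ih (h.quotSMulTop hx) hq')
      have h1 : q.height + 1 ≤ q'.height := Ideal.height_add_one_le_of_lt_of_isPrime hlt
      have h2 : q.height + ((e + 1 : ℕ) : ℕ∞) ≤ q'.height + e := by
        push_cast
        rw [add_comm (e : ℕ∞), ← add_assoc]
        gcongr
      exact_mod_cast h2

/-- For `e = dim R` this bounds the length below by the height of `p`, which makes the maximal
Cohen--Macaulay property localize. Regular elements are taken from `p` until it lies in an
associated prime, where the height bound applies. -/
lemma exists_isWeaklyRegular_of_mem_support [Module.Finite R X] {e : ℕ} (h : ExtDepthGE R X e)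
    {p : PrimeSpectrum R} (hp : p ∈ Module.support R X) :
    ∃ rs : List R, (∀ r ∈ rs, r ∈ p.asIdeal) ∧ IsWeaklyRegular X rs ∧
      ((p.asIdeal.height + e : ℕ∞) : WithBot ℕ∞) ≤ ringKrullDim R + rs.length := by
  induction e generalizing X with
  | zero =>
    refine ⟨[], by simp, .nil R X, ?_⟩
    simpa using Ideal.height_le_ringKrullDim_of_ne_top p.2.ne_top
  | succ e ih =>
    by_cases! H : ∃ q ∈ associatedPrimes R X, p.asIdeal ≤ q
    · obtain ⟨q, hq, hpq⟩ := H
      refine ⟨[], by simp, .nil R X, ?_⟩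
      have h1 : (p.asIdeal.height + (e + 1 : ℕ) : ℕ∞) ≤ q.height + (e + 1 : ℕ) := by
        gcongr
      refine (WithBot.coe_le_coe.mpr h1).trans ?_
      simpa using height_add_le_of_mem_associatedPrimes h hq
    · obtain ⟨x, hxp, hx⟩ := exists_mem_isSMulRegular H
      obtain ⟨rs, hmem, hreg, hle⟩ := ih (h.quotSMulTop hx) (mem_support_quotSMulTop hp hxp)
      refine ⟨x :: rs, by simpa [hxp] using hmem, .cons hx hreg, ?_⟩
      have := add_le_add_left hle 1
      simpa [add_assoc] using this

end ExtDepth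

/-! ### Comparison with depth defined by regular sequences -/

section DepthComparison

variable {R X : Type u} [CommRing R] [IsLocalRing R] [AddCommGroup X] [Module R X]

lemma le_depth {rs : List R} (hmem : ∀ r ∈ rs, r ∈ maximalIdeal R) (hreg : IsWeaklyRegular X rs) :
    (rs.length : ℕ∞) ≤ depth R X :=
  le_iSup₂ (f := fun (rs : List R) (_ : (∀ r ∈ rs, r ∈ maximalIdeal R) ∧ IsWeaklyRegular X rs) ↦
    (rs.length : ℕ∞)) rs ⟨hmem, hreg⟩

lemma depth_le_ringKrullDim [IsNoetherianRing R] [Module.Finite R X] [Nontrivial X] :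
    (depth R X : WithBot ℕ∞) ≤ ringKrullDim R := by
  obtain ⟨n, hn⟩ : ∃ n : ℕ∞, ringKrullDim R = n := ⟨_, (WithBot.coe_unbot _
    ringKrullDim_ne_bot).symm⟩
  rw [hn, WithBot.coe_le_coe]
  refine iSup₂_le fun rs hrs ↦ ?_
  have hreg := IsRegular.of_isWeaklyRegular_of_mem_maximalIdeal X hrs.1 hrs.2
  have h := Module.supportDim_add_length_eq_supportDim_of_isRegular rs hreg
  have hnt : Nontrivial (X ⧸ Ideal.ofList rs • (⊤ : Submodule R X)) :=
    hreg.quot_ofList_smul_nontrivial ⊤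
  have h0 : 0 ≤ Module.supportDim R (X ⧸ Ideal.ofList rs • (⊤ : Submodule R X)) := by
    obtain ⟨m, hm⟩ : ∃ m : ℕ∞, Module.supportDim R (X ⧸ Ideal.ofList rs • (⊤ : Submodule R X)) = m :=
      ⟨_, (WithBot.coe_unbot _ (Module.supportDim_ne_bot_of_nontrivial R _)).symm⟩
    rw [hm]
    exact_mod_cast (zero_le : 0 ≤ m)
  rw [← WithBot.coe_le_coe, ← hn]
  calc ((rs.length : ℕ∞) : WithBot ℕ∞) = 0 + rs.length := by simp
    _ ≤ Module.supportDim R (X ⧸ Ideal.ofList rs • (⊤ : Submodule R X)) + rs.length := by gcongr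
    _ = Module.supportDim R X := h
    _ ≤ ringKrullDim R := Module.supportDim_le_ringKrullDim R X

lemma exists_isWeaklyRegular_of_le_depth {e : ℕ} (h : (e : ℕ∞) ≤ depth R X) :
    ∃ rs : List R, e ≤ rs.length ∧ (∀ r ∈ rs, r ∈ maximalIdeal R) ∧ IsWeaklyRegular X rs := by
  match e with
  | 0 => exact ⟨[], le_rfl, by simp, .nil R X⟩
  | e + 1 =>
    -- A strict inequality below the supremum is witnessed by an actual sequence, even if the
    -- supremum is infinite.
    have h' : (e : ℕ∞) < depth R X := lt_of_lt_of_le (by exact_mod_cast Nat.lt_succ_self e) h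
    obtain ⟨rs, hrs⟩ := lt_iSup_iff.mp h'
    obtain ⟨hrs', hlt⟩ := lt_iSup_iff.mp hrs
    exact ⟨rs, by exact_mod_cast hlt, hrs'⟩

lemma extDepthGE_of_isWeaklyRegular [IsNoetherianRing R] [Module.Finite R X] {e : ℕ}
    {rs : List R} (he : e ≤ rs.length) (hmem : ∀ r ∈ rs, r ∈ maximalIdeal R)
    (hreg : IsWeaklyRegular X rs) : ExtDepthGE R X e := by
  cases subsingleton_or_nontrivial X with
  | inl h => exact .of_subsingleton e
  | inr h => exact (extDepthGE_iff_exists_isRegular.mpr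
      ⟨rs, rfl, hmem, .of_isWeaklyRegular_of_mem_maximalIdeal X hmem hreg⟩).mono he

lemma isUnit_of_mem_primeCompl_maximalIdeal (s : (maximalIdeal R).primeCompl) :
    IsUnit (s : R) :=
  notMem_maximalIdeal.mp s.2

variable (R X) in
lemma bijective_mkLinearMap_maximalIdeal :
    Function.Bijective (LocalizedModule.mkLinearMap (maximalIdeal R).primeCompl X) := by
  constructor
  · intro x y hxy
    obtain ⟨s, hs⟩ := (IsLocalizedModule.eq_iff_exists (maximalIdeal R).primeCompl _).mp hxy
    exact (isUnit_of_mem_primeCompl_maximalIdeal s).smul_left_cancel.mp hs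
  · intro y
    obtain ⟨⟨x, s⟩, hx⟩ := IsLocalizedModule.surj (maximalIdeal R).primeCompl
      (LocalizedModule.mkLinearMap (maximalIdeal R).primeCompl X) y
    obtain ⟨v, hv⟩ := (isUnit_of_mem_primeCompl_maximalIdeal s).exists_left_inv
    refine ⟨v • x, ?_⟩
    rw [map_smul, ← hx, Submonoid.smul_def, smul_smul, hv, one_smul]

lemma algebraMap_localization_maximalIdeal_surjective :
    Function.Surjective (algebraMap R (Localization.AtPrime (maximalIdeal R))) := by
  intro y
  obtain ⟨⟨x, s⟩, hx⟩ := IsLocalization.surj (maximalIdeal R).primeCompl y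
  obtain ⟨v, hv⟩ := (isUnit_of_mem_primeCompl_maximalIdeal s).exists_right_inv
  refine ⟨x * v, ?_⟩
  rw [map_mul, ← hx, mul_assoc, ← map_mul, hv, map_one, mul_one]

/-- Only the closed point is needed: localizing there changes nothing, so regular sequences descend
to `R`. -/
lemma IsMaximalCohenMacaulay.extDepthGE [IsNoetherianRing R] (h : IsMaximalCohenMacaulay R X)
    {d : ℕ} (hd : ringKrullDim R = d) : ExtDepthGE R X d := by
  have := h.finite
  cases subsingleton_or_nontrivial X with
  | inl _ => exact .of_subsingleton d
  | inr _ =>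
    have hdepth := h.depth_eq (closedPoint R) (closedPoint_mem_support R X)
    change (depth (Localization.AtPrime (maximalIdeal R))
      (LocalizedModule (maximalIdeal R).primeCompl X) : WithBot ℕ∞) =
        ringKrullDim (Localization.AtPrime (maximalIdeal R)) at hdepth
    rw [IsLocalization.AtPrime.ringKrullDim_eq_height (maximalIdeal R),
      maximalIdeal_height_eq_ringKrullDim, hd] at hdepth
    have hdepth' : (d : ℕ∞) ≤ depth (Localization.AtPrime (maximalIdeal R))
      (LocalizedModule (maximalIdeal R).primeCompl X) := le_of_eq (by exact_mod_cast hdepth.symm)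
    obtain ⟨rs, hlen, hmem, hreg⟩ := exists_isWeaklyRegular_of_le_depth hdepth'
    obtain ⟨rs, rfl⟩ := (List.map_surjective_iff.mpr
      algebraMap_localization_maximalIdeal_surjective) rs
    refine extDepthGE_of_isWeaklyRegular (rs := rs) (by simpa using hlen) (fun r hr ↦ ?_) ?_
    · exact (IsLocalization.AtPrime.to_map_mem_maximal_iff _ (maximalIdeal R) r).mp
        (hmem _ (List.mem_map_of_mem hr))
    · rw [isWeaklyRegular_map_algebraMap_iff] at hreg
      exact ((LinearEquiv.ofBijective _
        (bijective_mkLinearMap_maximalIdeal R X)).isWeaklyRegular_congr rs).mpr hreg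

lemma ExtDepthGE.isMaximalCohenMacaulay [IsNoetherianRing R] [Module.Finite R X] {d : ℕ}
    (hd : ringKrullDim R = d) (h : ExtDepthGE R X d) : IsMaximalCohenMacaulay R X where
  finite := inferInstance
  depth_eq p hp := by
    have : Nontrivial (LocalizedModule p.asIdeal.primeCompl X) := Module.mem_support_iff.mp hp
    have : Module.Finite (Localization.AtPrime p.asIdeal)
      (LocalizedModule p.asIdeal.primeCompl X) := inferInstance
    refine le_antisymm depth_le_ringKrullDim ?_
    obtain ⟨rs, hmem, hreg, hle⟩ := exists_isWeaklyRegular_of_mem_support h hp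
    rw [IsLocalization.AtPrime.ringKrullDim_eq_height p.asIdeal, WithBot.coe_le_coe]
    have hlen : p.asIdeal.height ≤ rs.length := by
      rw [hd] at hle
      have : p.asIdeal.height + d ≤ (rs.length : ℕ∞) + d := by
        rw [add_comm (rs.length : ℕ∞)]
        exact_mod_cast hle
      exact (ENat.add_le_add_iff_right (ENat.natCast_ne_top d)).mp this
    refine hlen.trans ?_
    have hmem' : ∀ r ∈ rs.map (algebraMap R (Localization.AtPrime p.asIdeal)),
        r ∈ maximalIdeal (Localization.AtPrime p.asIdeal) := by
      intro r hr
      obtain ⟨a, ha, rfl⟩ := List.mem_map.mp hr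
      exact (IsLocalization.AtPrime.to_map_mem_maximal_iff _ p.asIdeal a).mpr (hmem a ha)
    simpa using le_depth hmem' (hreg.of_isLocalizedModule (Localization.AtPrime p.asIdeal)
      p.asIdeal.primeCompl (LocalizedModule.mkLinearMap p.asIdeal.primeCompl X))

lemma IsCohenMacaulayLocalRing.extDepthGE (hR : IsCohenMacaulayLocalRing R) {d : ℕ}
    (hd : ringKrullDim R = d) : ExtDepthGE R R d := by
  have := hR.isNoetherianRing
  have hdepth : (depth R R : WithBot ℕ∞) = d := hR.depth_eq.trans hd
  obtain ⟨rs, hlen, hmem, hreg⟩ :=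
    exists_isWeaklyRegular_of_le_depth (e := d) (X := R) (le_of_eq (by exact_mod_cast hdepth.symm))
  exact extDepthGE_of_isWeaklyRegular hlen hmem hreg

end DepthComparison

/-! ### Ext of quotients by regular sequences -/

section QuotientsByRegularSequences

variable {R X ω : Type u} [CommRing R] [AddCommGroup X] [Module R X] [AddCommGroup ω] [Module R ω]

lemma extVanishes_quotient_ofList {rs : List R} (hreg : IsWeaklyRegular X rs) {n : ℕ}
    (h : ∀ i > n, ExtVanishes R X ω i) :
    ∀ i > n + rs.length, ExtVanishes R (X ⧸ Ideal.ofList rs • (⊤ : Submodule R X)) ω i := by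
  induction rs generalizing X n with
  | nil =>
    intro i hi
    exact extVanishes_congr_left (Submodule.quotEquivOfEqBot _ (by simp)).symm (h i (by simpa using hi))
  | cons x rs ih =>
    intro i hi
    rw [isWeaklyRegular_cons_iff] at hreg
    refine extVanishes_congr_left
      (Submodule.quotOfListConsSMulTopEquivQuotSMulTopInner X x rs).symm
      (ih hreg.2 (n := n + 1) (fun j hj ↦ ?_) i (by simp at hi; omega))
    obtain ⟨j, rfl⟩ : ∃ j', j = j' + 1 := ⟨j - 1, by omega⟩
    exact extVanishes_last_left (f := LinearMap.lsmul R X x) hreg.1 (exact_smul_mkQ x)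
      (Submodule.mkQ_surjective _) (h _ (by omega)) (h j (by omega))

end QuotientsByRegularSequences

/-! ### Ext into a module of finite injective dimension -/

section FiniteInjectiveDimension

variable {R X ω : Type u} [CommRing R] [IsLocalRing R] [IsNoetherianRing R] [AddCommGroup X]
  [Module R X] [AddCommGroup ω] [Module R ω]

lemma exists_injective_residueField [Nontrivial X]
    (hX : Module.support R X ⊆ PrimeSpectrum.zeroLocus (maximalIdeal R)) :
    ∃ f : ResidueField R →ₗ[R] X, Function.Injective f := by
  obtain ⟨q, hq⟩ := associatedPrimes.nonempty R X
  obtain ⟨hqp, f, hf⟩ := (isAssociatedPrime_iff_exists_injective_linearMap _ _).mp hq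
  have hsupp : (⟨q, hqp⟩ : PrimeSpectrum R) ∈ Module.support R X := by
    refine Module.support_subset_of_injective f hf ?_
    rw [Module.support_eq_zeroLocus, Ideal.annihilator_quotient]
    exact le_refl q
  obtain rfl : q = maximalIdeal R := le_antisymm (le_maximalIdeal hqp.ne_top) (hX hsupp)
  exact ⟨f, hf⟩

/-- Dévissage: a prime filtration of `X` has only `k` as a factor. -/
lemma extVanishes_of_support_subset [Module.Finite R X] {i : ℕ}
    (hk : ExtVanishes R (ResidueField R) ω i)
    (hX : Module.support R X ⊆ PrimeSpectrum.zeroLocus (maximalIdeal R)) :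
    ExtVanishes R X ω i := by
  revert hX
  induction ‹Module.Finite R X› using
    IsNoetherianRing.induction_on_isQuotientEquivQuotientPrime R with
  | subsingleton N => exact fun _ ↦ extVanishes_of_subsingleton_left i
  | quotient N p l =>
    intro hN
    have hp : p ∈ Module.support R N := by
      rw [l.support_eq, Module.support_eq_zeroLocus, Ideal.annihilator_quotient]
      exact le_refl p.asIdeal
    have : p = closedPoint R := PrimeSpectrum.ext
      (le_antisymm (le_maximalIdeal p.2.ne_top) (hN hp))
    subst this
    exact extVanishes_congr_left l.symm hk
  | exact N₁ N₂ N₃ f g hf hg hfg h₁ h₃ =>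
    exact fun hN ↦ extVanishes_middle_left hf hfg hg
      (h₁ ((Module.support_subset_of_injective f hf).trans hN))
      (h₃ ((Module.support_subset_of_surjective g hg).trans hN))

/-- Multiplication by `x` is onto the finitely generated module `Ext^i(X, ω)`, so Nakayama applies.
-/
lemma extVanishes_of_quotSMulTop [Module.Finite R X] [Module.Finite R ω] {x : R}
    (hx : IsSMulRegular X x) (hxm : x ∈ maximalIdeal R) {i : ℕ}
    (h : ExtVanishes R (QuotSMulTop x X) ω (i + 1)) : ExtVanishes R X ω i := by
  have hsurj (y : Ext (ModuleCat.of R X) (ModuleCat.of R ω) i) : ∃ z, x • z = y := by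
    obtain ⟨z, hz⟩ : ∃ z, (Ext.mk₀ (x • 𝟙 (ModuleCat.of R X))).comp z (zero_add i) = y :=
      Ext.contravariant_sequence_exact₁
        (IsSMulRegular.smulShortComplex_shortExact (M := ModuleCat.of R X) hx)
        (ModuleCat.of R ω) y (add_comm 1 i) (h.elim _ _)
    exact ⟨z, by rw [← hz, Ext.mk₀_smul, Ext.smul_comp, Ext.mk₀_id_comp]⟩
  by_contra! H
  refine Submodule.top_ne_pointwise_smul_of_mem_jacobson_annihilator
    (R := R) (M := Ext (ModuleCat.of R X) (ModuleCat.of R ω) i) (r := x)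
    (maximalIdeal_le_jacobson _ hxm) ?_
  refine (eq_top_iff.mpr fun y _ ↦ ?_).symm
  obtain ⟨z, rfl⟩ := hsurj y
  exact Submodule.smul_mem_pointwise_smul _ _ _ trivial

lemma extVanishes_of_quotient_ofList [Module.Finite R X] [Module.Finite R ω] {rs : List R}
    (hreg : IsWeaklyRegular X rs) (hmem : ∀ r ∈ rs, r ∈ maximalIdeal R) {n : ℕ}
    (h : ∀ i > n + rs.length, ExtVanishes R (X ⧸ Ideal.ofList rs • (⊤ : Submodule R X)) ω i) :
    ∀ i > n, ExtVanishes R X ω i := by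
  induction rs generalizing X n with
  | nil =>
    intro i hi
    exact extVanishes_congr_left (Submodule.quotEquivOfEqBot _ (by simp)) (h i (by simpa using hi))
  | cons x rs ih =>
    intro i hi
    rw [isWeaklyRegular_cons_iff] at hreg
    refine extVanishes_of_quotSMulTop hreg.1 (hmem x (by simp))
      (ih hreg.2 (fun r hr ↦ hmem r (by simp [hr])) (n := n + 1) (fun j hj ↦ ?_) _ (by omega))
    exact extVanishes_congr_left (Submodule.quotOfListConsSMulTopEquivQuotSMulTopInner X x rs)
      (h j (by simp; omega))

lemma support_quotient_ofList_subset [Module.Finite R X] {rs : List R} (hreg : IsRegular X rs)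
    (hd : ringKrullDim R = rs.length) :
    Module.support R (X ⧸ Ideal.ofList rs • (⊤ : Submodule R X)) ⊆
      PrimeSpectrum.zeroLocus (maximalIdeal R) := by
  have hnt : Nontrivial (X ⧸ Ideal.ofList rs • (⊤ : Submodule R X)) :=
    hreg.quot_ofList_smul_nontrivial ⊤
  have h := Module.supportDim_add_length_eq_supportDim_of_isRegular rs hreg
  have hle := Module.supportDim_le_ringKrullDim R X
  obtain ⟨m, hm⟩ : ∃ m : ℕ∞, Module.supportDim R (X ⧸ Ideal.ofList rs • (⊤ : Submodule R X)) = m :=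
    ⟨_, (WithBot.coe_unbot _ (Module.supportDim_ne_bot_of_nontrivial R _)).symm⟩
  refine (support_of_supportDim_eq_zero R _ ?_).subset
  rw [← h, hm, hd] at hle
  have hle' : m + rs.length ≤ (0 : ℕ∞) + rs.length := by
    rw [zero_add]
    exact_mod_cast hle
  have : m ≤ 0 := (ENat.add_le_add_iff_right (ENat.natCast_ne_top _)).mp hle'
  rw [hm, nonpos_iff_eq_zero.mp this]
  rfl

/-- The bound `n` improves to `d` by descending induction: `k` embeds in `R/(rs)`, for `rs` a
regular sequence of length `d`. The Ext of this quotient vanishes above `d`, and the cokernel is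
supported at the closed point. -/
lemma extVanishes_residueField {d n : ℕ} (hd : ringKrullDim R = d) (hR : ExtDepthGE R R d)
    (hω : ∀ i > n, ExtVanishes R (ResidueField R) ω i) :
    ∀ i > d, ExtVanishes R (ResidueField R) ω i := by
  obtain ⟨rs, rfl, hmem, hreg⟩ := extDepthGE_iff_exists_isRegular.mp hR
  have hnt : Nontrivial (R ⧸ Ideal.ofList rs • (⊤ : Submodule R R)) :=
    hreg.quot_ofList_smul_nontrivial ⊤
  have hsupp := support_quotient_ofList_subset hreg hd
  obtain ⟨f, hf⟩ := exists_injective_residueField hsupp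
  have hQ : ∀ i > rs.length, ExtVanishes R (R ⧸ Ideal.ofList rs • (⊤ : Submodule R R)) ω i := by
    intro i hi
    refine extVanishes_quotient_ofList hreg.1 (n := 0) (fun i hi ↦ ?_) i (by omega)
    obtain ⟨j, rfl⟩ : ∃ j, i = j + 1 := ⟨i - 1, by omega⟩
    exact extVanishes_of_projective j
  have key : ∀ m : ℕ, ∀ i > rs.length, n < i + m → ExtVanishes R (ResidueField R) ω i := by
    intro m
    induction m with
    | zero => exact fun i _ hi ↦ hω i hi
    | succ m ih =>
      intro i hi hm
      refine extVanishes_first_left hf (LinearMap.exact_map_mkQ_range f)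
        (Submodule.mkQ_surjective _) (hQ i hi)
        (extVanishes_of_support_subset (ih (i + 1) (by omega) (by omega)) ?_)
      exact (Module.support_subset_of_surjective _ (Submodule.mkQ_surjective _)).trans hsupp
  exact fun i hi ↦ key (n + 1) i hi (by omega)

lemma ExtDepthGE.extVanishes [Module.Finite R X] [Module.Finite R ω] {d n : ℕ}
    (hd : ringKrullDim R = d) (hR : ExtDepthGE R R d)
    (hω : ∀ i > n, ExtVanishes R (ResidueField R) ω i) (hX : ExtDepthGE R X d) :
    ∀ i > 0, ExtVanishes R X ω i := by
  cases subsingleton_or_nontrivial X with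
  | inl h => exact fun i _ ↦ extVanishes_of_subsingleton_left i
  | inr h =>
    obtain ⟨rs, rfl, hmem, hreg⟩ := extDepthGE_iff_exists_isRegular.mp hX
    refine extVanishes_of_quotient_ofList hreg.1 hmem fun i hi ↦ ?_
    exact extVanishes_of_support_subset (extVanishes_residueField hd hR hω i (by omega))
      (support_quotient_ofList_subset hreg hd)

end FiniteInjectiveDimension

/-! ### Depth of Hom modules -/

section HomDepth

variable {R M N F : Type u} [CommRing R] [AddCommGroup M] [AddCommGroup N]
  [AddCommGroup F] [Module R M] [Module R N] [Module R F]

variable (N) in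
/-- The restriction `Hom(F, N) → Hom(ker π, N)` for a linear map `π` defined on `F`. -/
noncomputable abbrev restrictKer (π : F →ₗ[R] M) :
    (F →ₗ[R] N) →ₗ[R] (LinearMap.ker π →ₗ[R] N) :=
  LinearMap.lcomp R N (LinearMap.ker π).subtype

lemma lcomp_injective {π : F →ₗ[R] M} (hπ : Function.Surjective π) :
    Function.Injective (LinearMap.lcomp R N π) :=
  fun _ _ h ↦ (LinearMap.cancel_right hπ).mp h

lemma exact_lcomp_restrictKer {π : F →ₗ[R] M} (hπ : Function.Surjective π) :
    Function.Exact (LinearMap.lcomp R N π) (restrictKer N π) := by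
  intro φ
  constructor
  · intro h
    have hle : LinearMap.ker π ≤ LinearMap.ker φ := fun x hx ↦ by
      simpa using DFunLike.congr_fun h ⟨x, hx⟩
    refine ⟨(LinearMap.ker π).liftQ φ hle ∘ₗ
      (π.quotKerEquivOfSurjective hπ).symm.toLinearMap, LinearMap.ext fun x ↦ ?_⟩
    have : (π.quotKerEquivOfSurjective hπ).symm (π x) = (LinearMap.ker π).mkQ x := by
      rw [LinearEquiv.symm_apply_eq]
      rfl
    simp [this]
  · rintro ⟨ψ, rfl⟩
    ext x
    simp [LinearMap.mem_ker.mp x.2]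

lemma exact_lcomp_rangeRestrict {π : F →ₗ[R] M} (hπ : Function.Surjective π) :
    Function.Exact (LinearMap.lcomp R N π) (restrictKer N π).rangeRestrict := by
  intro φ
  rw [← exact_lcomp_restrictKer hπ φ, ← Subtype.val_inj]
  rfl

lemma restrictKer_surjective {π : F →ₗ[R] M} (hπ : Function.Surjective π)
    (h : ExtVanishes R M N 1) : Function.Surjective (restrictKer N π) :=
  exists_extension_of_extVanishes (LinearMap.ker π).injective_subtype π.exact_subtype_ker_map hπ h

lemma extVanishes_ker {π : F →ₗ[R] M} (hπ : Function.Surjective π) [Module.Projective R F] {i : ℕ}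
    (hi : 1 ≤ i) (h : ExtVanishes R M N (i + 1)) : ExtVanishes R (LinearMap.ker π) N i := by
  obtain ⟨i, rfl⟩ : ∃ j, i = j + 1 := ⟨i - 1, by omega⟩
  exact extVanishes_first_left (LinearMap.ker π).injective_subtype π.exact_subtype_ker_map hπ
    (extVanishes_of_projective i) h

variable [IsLocalRing R]

lemma extDepthGE_linearMap_of_range {π : F →ₗ[R] M} (hπ : Function.Surjective π)
    [Module.Free R F] [Module.Finite R F] {e : ℕ} (hN : ExtDepthGE R N (e + 1))
    (h : ExtDepthGE R (LinearMap.range (restrictKer N π)) e) :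
    ExtDepthGE R (M →ₗ[R] N) (e + 1) :=
  .of_shortExact (lcomp_injective hπ) (exact_lcomp_rangeRestrict hπ)
    (LinearMap.surjective_rangeRestrict _) hN.linearMap_of_free h

variable [IsNoetherianRing R]

/-- When `Ext^1(M, N) = 0` the image is all of `Hom(ker π, N)`, so induction applies to the syzygy
with Ext shifted by one. Without any vanishing, the image embeds in `Hom(F', N)`, which already
gives depth 1. -/
lemma extDepthGE_range_restrictKer [Module.Finite R M] {π : F →ₗ[R] M}
    (hπ : Function.Surjective π) [Module.Free R F] [Module.Finite R F] {e : ℕ}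
    (hN : ExtDepthGE R N (e + 1)) (h : ∀ i, 1 ≤ i → i ≤ e → ExtVanishes R M N i) :
    ExtDepthGE R (LinearMap.range (restrictKer N π)) (e + 1) := by
  induction e generalizing M F with
  | zero =>
    obtain ⟨F', _, _, _, _, π', hπ'⟩ :=
      Module.exists_finite_presentation.{u} R (LinearMap.ker π)
    exact hN.linearMap_of_free.of_injective (f := (LinearMap.lcomp R N π') ∘ₗ
      (LinearMap.range (restrictKer N π)).subtype)
      ((lcomp_injective hπ').comp (Submodule.injective_subtype _))
  | succ e ih =>
    obtain ⟨F', _, _, _, _, π', hπ'⟩ :=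
      Module.exists_finite_presentation.{u} R (LinearMap.ker π)
    have hrange := ih hπ' (hN.mono (by omega)) fun i hi hie ↦
      extVanishes_ker hπ hi (h (i + 1) (by omega) (by omega))
    refine (extDepthGE_linearMap_of_range hπ' hN hrange).congr
      (LinearEquiv.ofTop _ (LinearMap.range_eq_top.mpr ?_)).symm
    exact restrictKer_surjective hπ (h 1 le_rfl (by omega))

lemma extDepthGE_linearMap [Module.Finite R M] {e : ℕ} (hN : ExtDepthGE R N e)
    (h : ∀ i, 1 ≤ i → i ≤ e → ExtVanishes R M N i) : ExtDepthGE R (M →ₗ[R] N) e := by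
  match e with
  | 0 => exact fun i hi ↦ absurd hi (by omega)
  | e + 1 =>
    obtain ⟨F, _, _, _, _, π, hπ⟩ := Module.exists_finite_presentation.{u} R M
    exact extDepthGE_linearMap_of_range hπ hN ((extDepthGE_range_restrictKer hπ hN
      fun i hi hie ↦ h i hi (by omega)).mono (by omega))

end HomDepth

/-! ### The evaluation map -/

section TensorEvaluation

variable (R : Type u) [CommRing R] (M N ω : Type u) [AddCommGroup M] [AddCommGroup N]
  [AddCommGroup ω] [Module R M] [Module R N] [Module R ω]

/-- The natural map `M ⊗ Hom(N, ω) → Hom(Hom(M, N), ω)` sending `m ⊗ f` to `g ↦ f (g m)`. -/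
noncomputable def tensorEval : M ⊗[R] (N →ₗ[R] ω) →ₗ[R] ((M →ₗ[R] N) →ₗ[R] ω) :=
  TensorProduct.lift ((LinearMap.llcomp R (M →ₗ[R] N) N ω).flip ∘ₗ LinearMap.applyₗ)

variable {R M N ω}

@[simp]
lemma tensorEval_tmul_apply (m : M) (f : N →ₗ[R] ω) (g : M →ₗ[R] N) :
    tensorEval R M N ω (m ⊗ₜ f) g = f (g m) := rfl

lemma tensorEval_rTensor {F : Type u} [AddCommGroup F] [Module R F] (π : F →ₗ[R] M)
    (t : F ⊗[R] (N →ₗ[R] ω)) :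
    tensorEval R M N ω (π.rTensor (N →ₗ[R] ω) t) =
      tensorEval R F N ω t ∘ₗ LinearMap.lcomp R N π := by
  induction t with
  | zero => simp
  | add x y hx hy => simp [hx, hy, LinearMap.add_comp]
  | tmul m f => ext g; simp

lemma tensorEval_bijective_of_free [Module.Free R M] [Module.Finite R M] :
    Function.Bijective (tensorEval R M N ω) := by
  let b := Module.Free.chooseBasis R M
  -- The `i`-th coefficient is `θ` restricted to the copy of `N` in `Hom(M, N)` at the `i`-th dual
  -- basis vector.
  let inv (θ : (M →ₗ[R] N) →ₗ[R] ω) : M ⊗[R] (N →ₗ[R] ω) :=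
    ∑ i, b i ⊗ₜ (θ ∘ₗ (LinearMap.smulRightₗ (R := R) (M₂ := M) (M := N) (b.coord i)))
  have hinv_add (θ θ' : (M →ₗ[R] N) →ₗ[R] ω) : inv (θ + θ') = inv θ + inv θ' := by
    simp [inv, LinearMap.add_comp, TensorProduct.tmul_add, Finset.sum_add_distrib]
  have hinv_zero : inv 0 = 0 := by simp [inv]
  refine Function.bijective_iff_has_inverse.mpr ⟨inv, fun t ↦ ?_, fun θ ↦ ?_⟩
  · induction t with
    | zero => rw [map_zero, hinv_zero]
    | add x y hx hy => rw [map_add, hinv_add, hx, hy]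
    | tmul m f =>
      have h (i) : tensorEval R M N ω (m ⊗ₜ f) ∘ₗ
          (LinearMap.smulRightₗ (R := R) (M₂ := M) (M := N) (b.coord i)) = b.repr m i • f := by
        ext n
        simp
      simp only [inv, h, TensorProduct.tmul_smul, TensorProduct.smul_tmul']
      rw [← TensorProduct.sum_tmul, b.sum_repr]
  · ext g
    have hg : ∑ i, (b.coord i).smulRight (g (b i)) = g := by
      ext x
      conv_rhs => rw [← b.sum_repr x, map_sum]
      simp
    conv_rhs => rw [← hg]
    simp [inv, map_sum, LinearMap.sum_apply]

variable {F : Type u} [AddCommGroup F] [Module R F] {π : F →ₗ[R] M}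

lemma tensorEval_surjective (hF : Function.Surjective (tensorEval R F N ω))
    (hπ : Function.Surjective (LinearMap.lcomp R ω (LinearMap.lcomp R N π))) :
    Function.Surjective (tensorEval R M N ω) := by
  intro θ
  obtain ⟨ψ, rfl⟩ := hπ θ
  obtain ⟨t, rfl⟩ := hF ψ
  exact ⟨_, tensorEval_rTensor π t⟩

/-- Lift `t` to `s` over `F`. Its evaluation kills `Hom(M, N)`, so it factors through `Hom(ker π,
N)` and comes from `u` over `ker π`. Injectivity over `F` makes `s` the image of `u`, which dies
over `M`. -/
lemma tensorEval_injective (hπ : Function.Surjective π)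
    (hF : Function.Injective (tensorEval R F N ω))
    (hK : Function.Surjective (tensorEval R (LinearMap.ker π) N ω))
    (hr : Function.Surjective (restrictKer N π)) :
    Function.Injective (tensorEval R M N ω) := by
  rw [injective_iff_map_eq_zero]
  intro t ht
  obtain ⟨s, rfl⟩ := LinearMap.rTensor_surjective (N →ₗ[R] ω) hπ t
  rw [tensorEval_rTensor] at ht
  have hle : LinearMap.ker (restrictKer N π) ≤ LinearMap.ker (tensorEval R F N ω s) := by
    intro φ hφ
    obtain ⟨ψ, rfl⟩ := (exact_lcomp_restrictKer hπ φ).mp hφ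
    exact DFunLike.congr_fun ht ψ
  obtain ⟨u, hu⟩ := hK ((LinearMap.ker (restrictKer N π)).liftQ (tensorEval R F N ω s) hle ∘ₗ
    ((restrictKer N π).quotKerEquivOfSurjective hr).symm.toLinearMap)
  have hs : s = (LinearMap.ker π).subtype.rTensor (N →ₗ[R] ω) u := by
    apply hF
    rw [tensorEval_rTensor, hu]
    ext φ
    have : ((restrictKer N π).quotKerEquivOfSurjective hr).symm (restrictKer N π φ) =
        (LinearMap.ker (restrictKer N π)).mkQ φ := by
      rw [LinearEquiv.symm_apply_eq]
      rfl
    simp only [LinearMap.comp_apply, LinearEquiv.coe_coe]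
    rw [this]
    simp
  have hzero : π ∘ₗ (LinearMap.ker π).subtype = 0 := by
    ext x
    simp
  rw [hs, ← LinearMap.comp_apply, ← LinearMap.rTensor_comp, hzero, LinearMap.rTensor_zero,
    LinearMap.zero_apply]

end TensorEvaluation

/-! ### Depth of the tensor product -/

section TensorDepth

variable {R M N ω : Type u} [CommRing R] [IsLocalRing R] [IsNoetherianRing R] [AddCommGroup M]
  [AddCommGroup N] [AddCommGroup ω] [Module R M] [Module R N] [Module R ω] [Module.Finite R M]
  [Module.Finite R N]

lemma tensorEval_surjective_of_extVanishes {e : ℕ} (hN : ExtDepthGE R N (e + 1))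
    (hω : ∀ (Y : Type u) [AddCommGroup Y] [Module R Y] [Module.Finite R Y],
      ExtDepthGE R Y (e + 1) → ∀ i > 0, ExtVanishes R Y ω i)
    (h : ∀ i, 1 ≤ i → i ≤ e → ExtVanishes R M N i) :
    Function.Surjective (tensorEval R M N ω) := by
  obtain ⟨F, _, _, _, _, π, hπ⟩ := Module.exists_finite_presentation.{u} R M
  refine tensorEval_surjective (π := π) tensorEval_bijective_of_free.2 fun θ ↦ ?_
  exact exists_extension_of_extVanishes (lcomp_injective hπ) (exact_lcomp_rangeRestrict hπ)
    (LinearMap.surjective_rangeRestrict _)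
    -- The cokernel of `Hom(M, N) → Hom(F, N)` has depth `e + 1`, so its first Ext into `ω`
    -- obstructs nothing.
    (hω _ (extDepthGE_range_restrictKer hπ hN h) 1 one_pos) θ

lemma tensorEval_bijective_of_extVanishes {e : ℕ} (hN : ExtDepthGE R N (e + 1))
    (hω : ∀ (Y : Type u) [AddCommGroup Y] [Module R Y] [Module.Finite R Y],
      ExtDepthGE R Y (e + 1) → ∀ i > 0, ExtVanishes R Y ω i)
    (h : ∀ i, 1 ≤ i → i ≤ e + 1 → ExtVanishes R M N i) :
    Function.Bijective (tensorEval R M N ω) := by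
  obtain ⟨F, _, _, _, _, π, hπ⟩ := Module.exists_finite_presentation.{u} R M
  refine ⟨tensorEval_injective hπ tensorEval_bijective_of_free.1 ?_
    (restrictKer_surjective hπ (h 1 le_rfl (by omega))),
    tensorEval_surjective_of_extVanishes hN hω fun i hi hie ↦ h i hi (by omega)⟩
  exact tensorEval_surjective_of_extVanishes hN hω fun i hi hie ↦
    extVanishes_ker hπ hi (h (i + 1) (by omega) (by omega))

lemma extDepthGE_tensorProduct [Module.Finite R ω] {d n : ℕ} (hd : ringKrullDim R = d)
    (hR : ExtDepthGE R R d) (hω : ExtDepthGE R ω d)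
    (hinj : ∀ i > n, ExtVanishes R (ResidueField R) ω i) (hN : ExtDepthGE R N d)
    (h : ∀ i, 1 ≤ i → i ≤ d → ExtVanishes R M N i) :
    ExtDepthGE R (M ⊗[R] (N →ₗ[R] ω)) d := by
  match d with
  | 0 => exact fun i hi ↦ absurd hi (by omega)
  | e + 1 =>
    have hvan (Y : Type u) [AddCommGroup Y] [Module R Y] [Module.Finite R Y]
        (hY : ExtDepthGE R Y (e + 1)) : ∀ i > 0, ExtVanishes R Y ω i :=
      ExtDepthGE.extVanishes hd hR hinj hY
    have hdual : ExtDepthGE R ((M →ₗ[R] N) →ₗ[R] ω) (e + 1) :=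
      extDepthGE_linearMap hω fun i hi _ ↦ hvan _ (extDepthGE_linearMap hN h) i hi
    exact hdual.congr
      (LinearEquiv.ofBijective _ (tensorEval_bijective_of_extVanishes hN hvan h)).symm

end TensorDepth

end CohenMacaulay

theorem mainTheorem8 (R : Type u) [CommRing R] [IsLocalRing R]
    (hR : CohenMacaulay.IsCohenMacaulayLocalRing R)
    (d : ℕ) (hd : ringKrullDim R = d)
    (ω : Type u) [AddCommGroup ω] [Module R ω] (hω : CohenMacaulay.IsCanonicalModule R ω)
    (M N : Type u) [AddCommGroup M] [Module R M] [AddCommGroup N] [Module R N]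
    [Module.Finite R M] (hN : CohenMacaulay.IsMaximalCohenMacaulay R N)
    (hExt : ∀ i : ℕ, 1 ≤ i → i ≤ d →
      Subsingleton (CategoryTheory.Abelian.Ext (ModuleCat.of R M) (ModuleCat.of R N) i)) :
    CohenMacaulay.IsMaximalCohenMacaulay R (M ⊗[R] (N →ₗ[R] ω)) := by
  have := hR.isNoetherianRing
  have := hN.finite
  have := hω.isMaximalCohenMacaulay.finite
  obtain ⟨n, hn⟩ := hω.finite_injectiveDimension
  exact (CohenMacaulay.extDepthGE_tensorProduct hd (hR.extDepthGE hd)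
    (hω.isMaximalCohenMacaulay.extDepthGE hd)
    -- Injective dimension at most `n` means less than `n + 1`.
    (fun i hi ↦ CategoryTheory.HasInjectiveDimensionLT.subsingleton _ (n + 1) i hi _)
    (hN.extDepthGE hd) hExt).isMaximalCohenMacaulay hd
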